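/- Let $\mathsf{M}$ be a loopless matroid on a finite ground set $E$, with rank function $\mathrm{rk}$ and lattice of flats $\mathcal{L}(\mathsf{M})$ (ordered by inclusion). For $F\in\mathcal{L}(\mathsf{M})$ let $\mathsf{M}|_F$ and $\mathsf{M}/F$ denote the restriction to $F$ and the contraction by $F$. Let $\mu_{\mathsf{M}}=\mu[\emptyset,E]$ be the Möbius invariant of $\mathcal{L}(\mathsf{M})$, and let $$\chi_{\mathsf{M}}(t)=\sum_{F\in\mathcal{L}(\mathsf{M})}\mu_{\mathsf{M}|_F}\,t^{\mathrm{rk}(\mathsf{M}/F)}$$ be the characteristic polynomial. The Kazhdan–Lusztig polynomials $P_{\mathsf{M}}(t)\in\mathbb{Z}[t]$ form the unique family, indexed by loopless finite matroids, such that $P_{\mathsf{M}}(t)=1$ if $\mathrm{rk}(\mathsf{M})=0$, $\deg P_{\mathsf{M}}(t)<\tfrac12\mathrm{rk}(\mathsf{M})$ if $\mathrm{rk}(\mathsf{M})>0$, and $$t^{\mathrm{rk}(\mathsf{M})}P_{\mathsf{M}}(t^{-1})=\sum_{F\in\mathcal{L}(\mathsf{M})}\chi_{\mathsf{M}|_F}(t)\,P_{\mathsf{M}/F}(t)$$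 for every $\mathsf{M}$. The $Z$-polynomial of $\mathsf{M}$ is $$Z_{\mathsf{M}}(t)=\sum_{F\in\mathcal{L}(\mathsf{M})}t^{\mathrm{rk}(\mathsf{M}|_F)}P_{\mathsf{M}/F}(t).$$ Let $\mathsf{U}_{k,n}$ denote the uniform matroid of rank $k$ on $n$ elements, whose bases are all $k$-element subsets of the ground set. For all integers $n\ge k\ge 1$, $$\begin{aligned} Z_{\mathsf{U}_{k,n}}(t) ={}&\sum_{j=0}^{\lfloor k/2\rfloor}\sum_{i=0}^{k-2j}\frac{(-1)^{k-i+1}}{n-i-j}\binom{n}{1,i,j,n-k,k-i-j-1}(1+t)^i t^j\\ &+\sum_{j=0}^{\lfloor (k-1)/2\rfloor}\sum_{i=0}^{k-2j-1}\frac{(-1)^{k-i+1}}{n-i-j}\binom{n}{1,i,j,n-k,k-i-j-1}(1+t)^i t^{k-i-j}, \end{aligned}$$ where $\binom{n}{a_1,\dots,a_m}=\frac{n!}{a_1!\cdots a_m!}$ denotes the multinomial coefficient, and a term whose multinomial coefficient has a negative entry is zero. (The only such term is that with $(i,j)=(k,0)$ in the first sum, where the last entry is $-1$; if $n=k$, its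 denominator $n-i-j$ also vanishes, and the term is still zero.) -/

import Mathlib

open Polynomial
open scoped Matroid Nat

/-- The uniform matroid `U_{k,n}` of rank `k` on the ground set `Fin n` (for `k ≤ n`): a set is
independent iff it has at most `k` elements. By `uniformMatroid_isBase_iff`, its bases are exactly
the `k`-element subsets. -/
def uniformMatroid (k n : ℕ) : Matroid (Fin n) :=
  (IndepMatroid.ofFinite (E := Set.univ) Set.finite_univ (fun I => I.ncard ≤ k)
    (by simp)
    (fun I J hJ hIJ => (Set.ncard_le_ncard hIJ (Set.toFinite J)).trans hJ)
    (fun I J _ hJ hlt => by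
      obtain ⟨e, heJ, heI⟩ := Set.exists_mem_notMem_of_ncard_lt_ncard hlt
      refine ⟨e, heJ, heI, ?_⟩
      rw [Set.ncard_insert_of_notMem heI]
      omega)
    (fun I _ => Set.subset_univ I)).matroid

theorem uniformMatroid_ground (k n : ℕ) : (uniformMatroid k n).E = Set.univ := rfl

theorem uniformMatroid_indep_iff {k n : ℕ} {I : Set (Fin n)} :
    (uniformMatroid k n).Indep I ↔ I.ncard ≤ k := Iff.rfl

theorem uniformMatroid_isBase_iff {k n : ℕ} (hkn : k ≤ n) {B : Set (Fin n)} :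
    (uniformMatroid k n).IsBase B ↔ B.ncard = k := by
  rw [Matroid.isBase_iff_maximal_indep, maximal_iff]
  simp only [uniformMatroid_indep_iff]
  constructor
  · rintro ⟨hB, hmax⟩
    by_contra hne
    have hlt : B.ncard < (Set.univ : Set (Fin n)).ncard := by
      rw [Set.ncard_univ, Nat.card_fin]
      omega
    obtain ⟨e, -, he⟩ := Set.exists_mem_notMem_of_ncard_lt_ncard hlt
    have h := hmax (y := insert e B) (by rw [Set.ncard_insert_of_notMem he]; omega)
      (Set.subset_insert e B)
    exact he (h ▸ Set.mem_insert e B)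
  · rintro hB
    exact ⟨hB.le, fun J hJ hBJ => Set.eq_of_subset_of_ncard_le hBJ (by omega) (Set.toFinite J)⟩

namespace Matroid

variable {α : Type*} [Finite α]

/-- The rank of a matroid on a finite type, as a natural number. -/
noncomputable def natRank (M : Matroid α) : ℕ := M.eRank.toNat

/-- The underlying finite set of the lattice of flats `𝓛(M)`. -/
noncomputable def flats (M : Matroid α) : Finset (Set α) :=
  (Set.toFinite {F : Set α | M.IsFlat F}).toFinset

theorem mem_flats {M : Matroid α} {F : Set α} : F ∈ M.flats ↔ M.IsFlat F := by
  simp [flats]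

/-- The lattice of flats `𝓛(M)`, ordered by inclusion. -/
abbrev FlatLattice (M : Matroid α) : Type _ := {F : Set α // M.IsFlat F}

open Classical in
/-- Intervals in the lattice of flats are finite. -/
noncomputable instance (M : Matroid α) : LocallyFiniteOrder M.FlatLattice :=
  letI := Fintype.ofFinite M.FlatLattice
  Fintype.toLocallyFiniteOrder

open Classical in
/-- The Möbius invariant `μ_M`: the value of the Möbius function of the lattice of flats on its
least element `M.closure ∅` (which is `∅` when `M` is loopless) and its greatest element `M.E`. -/
noncomputable def moebiusInvariant (M : Matroid α) : ℤ :=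
  IncidenceAlgebra.mu ℤ (⟨M.closure ∅, M.isFlat_closure ∅⟩ : M.FlatLattice)
    (⟨M.E, M.ground_isFlat⟩ : M.FlatLattice)

/-- The characteristic polynomial `χ_M(t) = ∑_F μ_{M|F} t^{rk(M/F)}`, over all flats `F`. -/
noncomputable def charPoly (M : Matroid α) : ℤ[X] :=
  ∑ F ∈ M.flats, C (M ↾ F).moebiusInvariant * X ^ (M ／ F).natRank

theorem ncard_contract_ground_lt {M : Matroid α} {F : Set α} (hF : F ∈ M.flats)
    (hne : F ≠ M.loops) : (M ／ F).E.ncard < M.E.ncard := by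
  have hF' := mem_flats.1 hF
  have h1 : F.Nonempty := by
    rw [Set.nonempty_iff_ne_empty]
    rintro rfl
    exact hne (Set.subset_empty_iff.1 hF'.loops_subset).symm
  obtain ⟨e, he⟩ := h1
  rw [contract_ground]
  exact Set.ncard_lt_ncard
    ((Set.ssubset_iff_of_subset Set.sdiff_subset).2 ⟨e, hF'.subset_ground he, fun h => h.2 he⟩)
    (Set.toFinite _)

open Classical in
/-- The Kazhdan–Lusztig polynomial `P_M(t)` of a matroid. For loopless matroids it is the unique
assignment `M ↦ P_M(t) ∈ ℤ[t]` such that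

* `P_M(t) = 1` if `rk M = 0`;
* `deg P_M(t) < rk M / 2` if `rk M > 0`;
* `t^{rk M} P_M(t⁻¹) = ∑_F χ_{M|F}(t) P_{M/F}(t)`, the sum over all flats `F` of `M`.

The term of the least flat in this sum is `P_M(t)` itself, and every monomial of
`t^{rk M} P_M(t⁻¹)` has degree greater than `rk M / 2`. Hence `P_M(t)` is the negative of the part
of degree less than `rk M / 2` of the sum over the remaining flats, which is the recursion
below. (See `eq_klPoly` for the fact that these conditions force this recursion.) -/
noncomputable def klPoly (M : Matroid α) : ℤ[X] :=
  if M.natRank = 0 then 1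
  else
    -∑ i ∈ Finset.range M.natRank with 2 * i < M.natRank,
      monomial i
        ((∑ F ∈ (M.flats.filter (· ≠ M.loops)).attach,
          (M ↾ F.1).charPoly * klPoly (M ／ F.1)).coeff i)
termination_by M.E.ncard
decreasing_by
  exact ncard_contract_ground_lt (Finset.mem_filter.1 F.2).1 (Finset.mem_filter.1 F.2).2

open Classical in
/-- The recursion defining `klPoly`, without the bookkeeping needed for termination. -/
theorem klPoly_eq (M : Matroid α) (hM : M.natRank ≠ 0) :
    M.klPoly = -∑ i ∈ Finset.range M.natRank with 2 * i < M.natRank,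
      monomial i
        ((∑ F ∈ M.flats with F ≠ M.loops, (M ↾ F).charPoly * (M ／ F).klPoly).coeff i) := by
  rw [klPoly, if_neg hM,
    Finset.sum_attach (M.flats.filter (· ≠ M.loops))
      (fun F => (M ↾ F).charPoly * (M ／ F).klPoly)]

theorem charPoly_restrict_empty (M : Matroid α) : (M ↾ (∅ : Set α)).charPoly = 1 := by
  have h1 : (M ↾ (∅ : Set α)).flats = {∅} := by
    ext F
    rw [mem_flats, Finset.mem_singleton]
    constructor
    · intro h
      exact Set.subset_empty_iff.1 h.subset_ground
    · rintro rfl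
      exact (M ↾ (∅ : Set α)).ground_isFlat
  have h2 : ((M ↾ (∅ : Set α)) ↾ (∅ : Set α)).moebiusInvariant = 1 := by
    unfold moebiusInvariant
    rw [show (⟨_, ground_isFlat ((M ↾ (∅ : Set α)) ↾ (∅ : Set α))⟩ :
      FlatLattice ((M ↾ (∅ : Set α)) ↾ (∅ : Set α))) = ⟨_, isFlat_closure ∅⟩ from
        Subtype.ext (Set.subset_empty_iff.1 (isFlat_closure ∅).subset_ground).symm]
    exact IncidenceAlgebra.mu_self _
  have h3 : ((M ↾ (∅ : Set α)) ／ (∅ : Set α)).natRank = 0 := by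
    simp [natRank]
  rw [charPoly, h1, Finset.sum_singleton, h2, h3]
  simp

/-- Any assignment with the three defining properties of the Kazhdan–Lusztig polynomials of
loopless matroids agrees with `klPoly`. -/
theorem eq_klPoly (P : Matroid α → ℤ[X])
    (h0 : ∀ M : Matroid α, M.Loopless → M.natRank = 0 → P M = 1)
    (hdeg : ∀ M : Matroid α, M.Loopless → 0 < M.natRank → 2 * (P M).natDegree < M.natRank)
    (hrec : ∀ M : Matroid α, M.Loopless →
      (P M).reflect M.natRank = ∑ F ∈ M.flats, (M ↾ F).charPoly * P (M ／ F))
    (M : Matroid α) (hM : M.Loopless) : P M = M.klPoly := by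
  classical
  induction hm : M.E.ncard using Nat.strong_induction_on generalizing M with
  | _ m ih =>
    by_cases hr : M.natRank = 0
    · rw [h0 M hM hr, klPoly, if_pos hr]
    · have hl : M.loops = ∅ := (loopless_iff M).1 hM
      have hmem : (∅ : Set α) ∈ M.flats := by
        rw [mem_flats, ← hl]
        exact isFlat_closure ∅
      have hsplit := hrec M hM
      have hne : M.flats.filter (· ≠ M.loops) = M.flats.erase ∅ := by
        ext F
        simp [and_comm]
      rw [← Finset.add_sum_erase _ _ hmem, charPoly_restrict_empty, contract_empty, one_mul,
        ← hne] at hsplit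
      have hsum : ∑ F ∈ M.flats with F ≠ M.loops, (M ↾ F).charPoly * P (M ／ F) =
          ∑ F ∈ M.flats with F ≠ M.loops, (M ↾ F).charPoly * (M ／ F).klPoly := by
        refine Finset.sum_congr rfl fun F hF => ?_
        rw [Finset.mem_filter] at hF
        rw [ih _ (hm ▸ ncard_contract_ground_lt hF.1 hF.2) (M ／ F) _ rfl]
        rw [loopless_iff, contract_loops_eq, (mem_flats.1 hF.1).closure, Set.sdiff_self]
      rw [hsum] at hsplit
      have hd := hdeg M hM (Nat.pos_of_ne_zero hr)
      rw [klPoly_eq M hr]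
      ext i
      rw [coeff_neg, finsetSum_coeff]
      simp only [coeff_monomial, Finset.sum_ite_eq', Finset.mem_filter, Finset.mem_range]
      split_ifs with hi
      · have h := congrArg (fun p : ℤ[X] => p.coeff i) hsplit
        simp only [coeff_add, coeff_reflect, revAt_le hi.1.le] at h
        rw [coeff_eq_zero_of_natDegree_lt (show (P M).natDegree < M.natRank - i by omega)] at h
        omega
      · rw [coeff_eq_zero_of_natDegree_lt (by omega), neg_zero]

/-- The `Z`-polynomial `Z_M(t) = ∑_F t^{rk(M|F)} P_{M/F}(t)` of a loopless matroid. -/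
noncomputable def zPoly (M : Matroid α) : ℤ[X] :=
  ∑ F ∈ M.flats, X ^ (M ↾ F).natRank * (M ／ F).klPoly

end Matroid

/-- The multinomial coefficient `n! / (a₁! a₂! ⋯ aₘ!)`, which is `0` if some `aᵢ` is negative. -/
def multinomialCoeff (n : ℕ) (a : List ℤ) : ℚ :=
  if ∀ x ∈ a, 0 ≤ x then (n ! : ℚ) / (a.map fun x => (x.toNat ! : ℚ)).prod else 0

/-! Put `m = n - k`. The proper flats of `U_{k,n}` are the sets with fewer than `k` elements.
Restricting to such a flat of size `i` gives a Boolean matroid, and contracting it gives a uniform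
matroid of rank `k - i` and the same corank `m`. Sums over flats are therefore binomial convolutions
at fixed `m`, that is, products of power series in `x` whose coefficient of `x^k` is divided by `(k
+ m)!`.

Write `T_a = ∑_{l ≥ 1} (a x)^l / (l + m)!`, and let `K` be the series of the polynomials `P`. The
right side of the Kazhdan–Lusztig recursion has series `R = exp((t-1)x) K + exp(-x) (T_t - T_1)`,
and `Z` has series `exp(tx) K + T_t`. With `S = exp(-(1+t)x) (exp(tx) K + T_t)` these become `K =
exp(x) (S - exp(-(1+t)x) T_t)` and `R = exp(tx) (S - exp(-(1+t)x) T_1)`. The coefficient of `t^j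
x^l` is `weight m l j` in `exp(-(1+t)x) T_1`, and `weight m l (l - j)` in the version with `T_t`.
The palindromic `S` (`palSeries`) agrees with the former for `2j ≤ l` and with the latter for `2j ≥
l`. So the coefficients of `K` have degree below `k/2`, and those of `R` have no terms of degree at
most `k/2`; these two facts force `K` to be the Kazhdan–Lusztig series (`klPoly_map_eq`). Expanding
`exp((1+t)x) S` gives the formula, its two sums being the two halves of `S`. -/

namespace Matroid

variable {α : Type*} [Finite α] {M : Matroid α} {k : ℕ} {F : Set α}

/-! ### Flats and minors of uniform matroids. -/

omit [Finite α] in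
theorem natRank_contract_ground (M : Matroid α) : (M ／ M.E).natRank = 0 := by
  rw [natRank, ← eRk_ground]
  simp

/-- `M` is uniform of rank `k`: its independent sets are the subsets of the ground set with at
most `k` elements, and the ground set has at least `k` elements. -/
structure IsUniformOfRank (M : Matroid α) (k : ℕ) : Prop where
  indep_iff (I : Set α) : M.Indep I ↔ I ⊆ M.E ∧ I.ncard ≤ k
  le_ncard_ground : k ≤ M.E.ncard

namespace IsUniformOfRank

theorem natRank_eq (h : M.IsUniformOfRank k) : M.natRank = k := by
  obtain ⟨B, hB⟩ := M.exists_isBase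
  have hBk := (h.indep_iff B).1 hB.indep
  have hcard : B.ncard = k := by
    by_contra hne
    obtain ⟨e, heE, heB⟩ := Set.exists_mem_notMem_of_ncard_lt_ncard
      (lt_of_lt_of_le (lt_of_le_of_ne hBk.2 hne) h.le_ncard_ground)
    have hi : M.Indep (insert e B) := by
      rw [h.indep_iff, Set.ncard_insert_of_notMem heB]
      exact ⟨Set.insert_subset heE hBk.1, by omega⟩
    exact heB (hB.eq_of_subset_indep hi (Set.subset_insert e B) ▸ Set.mem_insert e B)
  rw [natRank, ← hB.encard_eq_eRank, ← hcard]
  rfl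

omit [Finite α] in
theorem closure_eq_self (h : M.IsUniformOfRank k) (hF : F ⊆ M.E) (hlt : F.ncard < k) :
    M.closure F = F := by
  have hi : M.Indep F := (h.indep_iff F).2 ⟨hF, hlt.le⟩
  ext e
  rw [hi.mem_closure_iff']
  constructor
  · rintro ⟨heE, he⟩
    refine he ((h.indep_iff _).2 ⟨Set.insert_subset heE hF, ?_⟩)
    exact (Set.ncard_insert_le e F).trans hlt
  · exact fun he => ⟨hF he, fun _ => he⟩

theorem isFlat_iff (h : M.IsUniformOfRank k) :
    M.IsFlat F ↔ F = M.E ∨ F ⊆ M.E ∧ F.ncard < k := by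
  constructor
  · intro hF
    by_cases hlt : F.ncard < k
    · exact Or.inr ⟨hF.subset_ground, hlt⟩
    · left
      refine hF.subset_ground.antisymm fun e he => ?_
      obtain ⟨I, hIF, hI⟩ := Set.exists_subset_card_eq (not_lt.1 hlt)
      have hi : M.Indep I := (h.indep_iff I).2 ⟨hIF.trans hF.subset_ground, hI.le⟩
      rw [← hF.closure]
      refine M.closure_subset_closure hIF (hi.mem_closure_iff'.2 ⟨he, fun hins => ?_⟩)
      by_contra heI
      have := ((h.indep_iff _).1 hins).2
      rw [Set.ncard_insert_of_notMem heI] at this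
      omega
  · rintro (rfl | ⟨hF, hlt⟩)
    · exact M.ground_isFlat
    · rw [isFlat_iff_closure_eq]
      exact h.closure_eq_self hF hlt

omit [Finite α] in
theorem loops_eq_empty (h : M.IsUniformOfRank k) (hk : 0 < k) : M.loops = ∅ :=
  h.closure_eq_self (Set.empty_subset _) (by simpa using hk)

theorem restrict (h : M.IsUniformOfRank k) (hF : F ⊆ M.E) (hle : F.ncard ≤ k) :
    (M ↾ F).IsUniformOfRank F.ncard where
  indep_iff I := by
    rw [restrict_indep_iff, h.indep_iff, restrict_ground_eq]
    constructor
    · exact fun hI => ⟨hI.2, Set.ncard_le_ncard hI.2⟩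
    · exact fun hI => ⟨⟨hI.1.trans hF, hI.2.trans hle⟩, hI.1⟩
  le_ncard_ground := le_rfl

theorem contract (h : M.IsUniformOfRank k) (hF : F ⊆ M.E) (hle : F.ncard ≤ k) :
    (M ／ F).IsUniformOfRank (k - F.ncard) where
  indep_iff I := by
    have hi : M.Indep F := (h.indep_iff F).2 ⟨hF, hle⟩
    rw [hi.contract_indep_iff, h.indep_iff, contract_ground, Set.subset_sdiff, Set.union_subset_iff]
    constructor
    · rintro ⟨hd, ⟨hI, -⟩, hc⟩
      rw [Set.ncard_union_eq hd] at hc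
      exact ⟨⟨hI, hd⟩, by omega⟩
    · rintro ⟨⟨hI, hd⟩, hc⟩
      rw [Set.ncard_union_eq hd]
      exact ⟨hd, ⟨hI, hF⟩, by omega⟩
  le_ncard_ground := by
    rw [contract_ground, Set.ncard_sdiff hF]
    exact Nat.sub_le_sub_right h.le_ncard_ground _

theorem ncard_contract_ground (hF : F ⊆ M.E) : (M ／ F).E.ncard = M.E.ncard - F.ncard := by
  rw [contract_ground, Set.ncard_sdiff hF]

/-- The ground set is kept apart: it is a flat of rank `k`, but its size is in general not `k`. -/
theorem sum_flats {R : Type*} [CommRing R] (h : M.IsUniformOfRank k) (f : Set α → R) (g : ℕ → R)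
    (hfg : ∀ F ⊆ M.E, F.ncard < k → f F = g F.ncard) :
    ∑ F ∈ M.flats, f F = ∑ i ∈ Finset.range k, (M.E.ncard.choose i : R) * g i + f M.E := by
  classical
  set E : Finset α := (Set.toFinite M.E).toFinset with hE
  have hcoe : (E : Set α) = M.E := by simp [hE]
  have hcard : E.card = M.E.ncard := by rw [← hcoe, Set.ncard_coe_finset]
  have hflats : M.flats = insert M.E ((E.powerset.filter (·.card < k)).image (fun s : Finset α => (s : Set α))) := by
    ext F
    rw [mem_flats, h.isFlat_iff, Finset.mem_insert, Finset.mem_image]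
    refine or_congr_right ⟨fun hF => ?_, ?_⟩
    · refine ⟨(Set.toFinite F).toFinset, ?_, by simp⟩
      rw [Finset.mem_filter, Finset.mem_powerset, ← Finset.coe_subset, hcoe,
        ← Set.ncard_coe_finset]
      simpa using hF
    · rintro ⟨s, hs, rfl⟩
      rw [Finset.mem_filter, Finset.mem_powerset, ← Finset.coe_subset, hcoe] at hs
      rwa [Set.ncard_coe_finset]
  rw [hflats, Finset.sum_insert, Finset.sum_image (by simp), add_comm]
  · congr 1
    have h1 : ∀ s ∈ E.powerset.filter (·.card < k), f s = g s.card := by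
      intro s hs
      rw [Finset.mem_filter, Finset.mem_powerset, ← Finset.coe_subset, hcoe] at hs
      rw [hfg s hs.1 (by rw [Set.ncard_coe_finset]; exact hs.2), Set.ncard_coe_finset]
    rw [Finset.sum_congr rfl h1, Finset.sum_filter,
      Finset.sum_powerset_apply_card (fun i => if i < k then g i else 0), hcard]
    have hsub : Finset.range k ⊆ Finset.range (M.E.ncard + 1) :=
      Finset.range_subset_range.2 (h.le_ncard_ground.trans (Nat.le_succ _))
    rw [← Finset.sum_subset hsub]
    · refine Finset.sum_congr rfl fun i hi => ?_
      rw [if_pos (Finset.mem_range.1 hi), nsmul_eq_mul]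
    · intro i _ hi
      rw [if_neg (by simpa using hi), smul_zero]
  · rw [Finset.mem_image]
    rintro ⟨s, hs, hsE⟩
    have h2 := (Finset.mem_filter.1 hs).2
    rw [← Set.ncard_coe_finset, hsE] at h2
    exact absurd h.le_ncard_ground (by omega)

/-! ### Möbius invariants and characteristic polynomials. -/

open Classical in
-- Every subset of a flat with fewer than `k` elements is a flat, so the interval below it is
-- Boolean.
theorem mu_eq_neg_one_pow (h : M.IsUniformOfRank k) {a : M.FlatLattice} (ha : a.1 = ∅) :
    ∀ (m : ℕ) (b : M.FlatLattice), b.1.ncard = m → m < k →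
      IncidenceAlgebra.mu ℤ a b = (-1) ^ m := by
  intro m
  induction m using Nat.strong_induction_on with
  | _ m ih =>
    intro b hb hm
    rw [IncidenceAlgebra.mu_apply]
    split_ifs with hab
    · subst hab
      rw [ha, Set.ncard_empty] at hb
      rw [← hb, pow_zero]
    · set B : Finset α := (Set.toFinite b.1).toFinset with hB
      have hcoe : (B : Set α) = b.1 := by simp [hB]
      have hcard : B.card = m := by rw [← hb, ← hcoe, Set.ncard_coe_finset]
      have hne : B.Nonempty := by
        rw [Finset.nonempty_iff_ne_empty]
        intro h0
        rw [h0, Finset.coe_empty] at hcoe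
        exact hab (Subtype.ext (ha.trans hcoe))
      have hlt : ∀ x ∈ Finset.Ico a b, x.1 ⊂ b.1 := fun x hx => (Finset.mem_Ico.1 hx).2
      have key : ∑ x ∈ Finset.Ico a b, IncidenceAlgebra.mu ℤ a x =
          ∑ s ∈ B.ssubsets, (-1 : ℤ) ^ s.card := by
        refine Finset.sum_bij (fun x _ => (Set.toFinite x.1).toFinset) ?_ ?_ ?_ ?_
        · intro x hx
          rw [Finset.mem_ssubsets, ← Finset.coe_ssubset, hcoe]
          simpa using hlt x hx
        · intro x _ y _ hxy
          apply Subtype.ext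
          simpa using hxy
        · intro s hs
          rw [Finset.mem_ssubsets, ← Finset.coe_ssubset, hcoe] at hs
          have hflat : M.IsFlat (s : Set α) := by
            rw [h.isFlat_iff]
            have := Set.ncard_lt_ncard hs
            exact Or.inr ⟨hs.1.trans b.2.subset_ground, by omega⟩
          refine ⟨⟨s, hflat⟩, ?_, by simp⟩
          rw [Finset.mem_Ico]
          refine ⟨?_, hs⟩
          change a.1 ⊆ s
          rw [ha]
          exact Set.empty_subset _
        · intro x hx
          have hx' := Set.ncard_lt_ncard (hlt x hx)
          rw [ih _ (hb ▸ hx') x rfl (by omega), ← Set.ncard_coe_finset]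
          simp
      have h0 := Finset.sum_powerset_neg_one_pow_card_of_nonempty hne
      rw [← Finset.insert_erase (Finset.mem_powerset_self B),
        Finset.sum_insert (Finset.notMem_erase _ _), hcard] at h0
      rw [key, Finset.ssubsets]
      linarith

theorem moebiusInvariant_eq (h : M.IsUniformOfRank k) (hk : 0 < k) :
    M.moebiusInvariant = -∑ i ∈ Finset.range k, (M.E.ncard.choose i : ℤ) * (-1) ^ i := by
  classical
  have hl : M.closure ∅ = ∅ := h.loops_eq_empty hk
  have hpos := h.le_ncard_ground
  have hE : M.E ≠ ∅ := fun h0 => by rw [h0, Set.ncard_empty] at hpos; omega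
  have hab : (⟨M.closure ∅, M.isFlat_closure ∅⟩ : M.FlatLattice) ≠ ⟨M.E, M.ground_isFlat⟩ :=
    fun h0 => hE ((congrArg Subtype.val h0).symm.trans hl)
  have hs := h.sum_flats (fun F => if F ≠ M.E then (-1 : ℤ) ^ F.ncard else 0)
    (fun i => (-1) ^ i) (fun F _ hF => if_pos (fun h0 => by rw [h0] at hF; omega))
  simp only [ne_eq, not_true_eq_false, if_false, add_zero] at hs
  rw [moebiusInvariant, IncidenceAlgebra.mu_apply, if_neg hab, ← hs, ← Finset.sum_filter]
  congr 1
  refine Finset.sum_bij (fun x _ => x.1) ?_ ?_ ?_ ?_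
  · intro x hx
    have hx' : x.1 ⊂ M.E := (Finset.mem_Ico.1 hx).2
    rw [Finset.mem_filter, mem_flats]
    exact ⟨x.2, hx'.ne⟩
  · exact fun x _ y _ hxy => Subtype.ext hxy
  · intro F hF
    rw [Finset.mem_filter, mem_flats] at hF
    refine ⟨⟨F, hF.1⟩, Finset.mem_Ico.2 ⟨?_, hF.1.subset_ground.ssubset_of_ne hF.2⟩, rfl⟩
    change M.closure ∅ ⊆ F
    rw [hl]
    exact Set.empty_subset _
  · intro x hx
    have hx' : x.1 ⊂ M.E := (Finset.mem_Ico.1 hx).2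
    refine h.mu_eq_neg_one_pow hl _ _ rfl ?_
    rcases h.isFlat_iff.1 x.2 with h1 | h1
    · exact absurd h1 hx'.ne
    · exact h1.2

theorem moebiusInvariant_of_ncard_ground (h : M.IsUniformOfRank k) (hk : M.E.ncard = k) :
    M.moebiusInvariant = (-1) ^ k := by
  classical
  rcases Nat.eq_zero_or_pos k with rfl | hpos
  · rw [moebiusInvariant, IncidenceAlgebra.mu_apply, if_pos, pow_zero]
    have hE : M.E = ∅ := (Set.ncard_eq_zero).1 hk
    exact Subtype.ext ((Set.subset_empty_iff.1 ((M.closure_subset_ground ∅).trans hE.subset)).trans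
      hE.symm)
  · have h0 := Int.alternating_sum_range_choose_of_ne hpos.ne'
    rw [Finset.sum_range_succ, Nat.choose_self] at h0
    rw [h.moebiusInvariant_eq hpos, hk]
    simp only [mul_comm (Nat.cast _ : ℤ)]
    push_cast at h0
    linarith

/-- The ground set contributes the constant `μ_M`, minus an alternating binomial sum; this supplies
the `-1` in each summand. -/
theorem charPoly_eq (h : M.IsUniformOfRank k) (hk : 0 < k) :
    M.charPoly = ∑ i ∈ Finset.range k, (M.E.ncard.choose i : ℤ[X]) *
      ((-1) ^ i * (X ^ (k - i) - 1)) := by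
  rw [charPoly, h.sum_flats _ (fun i => (-1) ^ i * X ^ (k - i))]
  · rw [restrict_ground_eq_self, h.moebiusInvariant_eq hk, M.natRank_contract_ground]
    simp only [mul_sub, Finset.sum_sub_distrib]
    simp [sub_eq_add_neg]
  · intro F hF hlt
    rw [(h.restrict hF hlt.le).moebiusInvariant_of_ncard_ground rfl,
      (h.contract hF hlt.le).natRank_eq]
    simp

theorem charPoly_of_ncard_ground (h : M.IsUniformOfRank k) (hk : 0 < k) (hE : M.E.ncard = k) :
    M.charPoly = (X - 1) ^ k := by
  have h1 := add_pow (-1 : ℤ[X]) X k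
  have h2 := add_pow (-1 : ℤ[X]) 1 k
  rw [neg_add_cancel, zero_pow hk.ne'] at h2
  -- Subtracting `(-1 + 1)^k = 0` from the expansion of `(-1 + X)^k` produces the factors `X ^ (k -
  -- i) - 1`; the one for `i = k` vanishes.
  rw [h.charPoly_eq hk, hE, sub_eq_neg_add, h1, ← sub_zero (Finset.sum (Finset.range (k + 1)) _),
    h2, ← Finset.sum_sub_distrib, Finset.sum_range_succ]
  simp only [Nat.sub_self, pow_zero, one_pow, sub_self, add_zero]
  exact Finset.sum_congr rfl fun i _ => by ring

end IsUniformOfRank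

end Matroid

theorem isUniformOfRank_uniformMatroid {k n : ℕ} (hkn : k ≤ n) :
    (uniformMatroid k n).IsUniformOfRank k where
  indep_iff I := by simp [uniformMatroid_indep_iff, uniformMatroid_ground]
  le_ncard_ground := by
    rw [uniformMatroid_ground, Set.ncard_univ, Nat.card_fin]
    exact hkn

/-! ### Exponential generating functions at fixed corank. -/

namespace UniformKL

/-- The exponential series `exp (a x)` over `ℚ[t]`. -/
noncomputable def expSeries (a : ℚ[X]) : PowerSeries ℚ[X] :=
  PowerSeries.rescale a (PowerSeries.exp ℚ[X])

theorem expSeries_mul (a b : ℚ[X]) : expSeries a * expSeries b = expSeries (a + b) :=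
  PowerSeries.exp_mul_exp_eq_exp_add a b

theorem coeff_expSeries (a : ℚ[X]) (i : ℕ) :
    PowerSeries.coeff i (expSeries a) = a ^ i * C ((i ! : ℚ)⁻¹) := by
  rw [expSeries, PowerSeries.coeff_rescale, PowerSeries.coeff_exp, one_div]
  rfl

/-- The series `∑_{l ≥ 1} (a x)^l / (l + m)!` over `ℚ[t]`. -/
noncomputable def tailSeries (m : ℕ) (a : ℚ[X]) : PowerSeries ℚ[X] :=
  PowerSeries.mk fun l => if l = 0 then 0 else a ^ l * C (((l + m)! : ℚ)⁻¹)

theorem coeff_zero_tailSeries (m : ℕ) (a : ℚ[X]) :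
    PowerSeries.coeff 0 (tailSeries m a) = 0 := by
  simp [tailSeries]

theorem coeff_tailSeries (m : ℕ) (a : ℚ[X]) {l : ℕ} (hl : l ≠ 0) :
    PowerSeries.coeff l (tailSeries m a) = a ^ l * C (((l + m)! : ℚ)⁻¹) := by
  simp [tailSeries, hl]

/-- The coefficient of `t^j x^l` in `exp (-(1 + t) x) * ∑_{l ≥ 1} x^l / (l + m)!`. -/
def weight (m l j : ℕ) : ℚ :=
  if j < l then
    (-1) ^ (l + 1) / (((l : ℚ) + m - j) * (j ! * m ! * (l - j - 1)!))
  else 0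

/-- The series with palindromic coefficients whose lower half is given by `weight`. -/
noncomputable def palSeries (m : ℕ) : PowerSeries ℚ[X] :=
  PowerSeries.mk fun l => ∑ j ∈ Finset.range (l + 1), monomial j (weight m l (min j (l - j)))

theorem coeff_coeff_palSeries (m l j : ℕ) :
    (PowerSeries.coeff l (palSeries m)).coeff j =
      if j ≤ l then weight m l (min j (l - j)) else 0 := by
  rw [palSeries, PowerSeries.coeff_mk, finsetSum_coeff]
  simp [coeff_monomial]

theorem coeff_zero_palSeries (m : ℕ) : PowerSeries.coeff 0 (palSeries m) = 0 := by
  simp [palSeries, weight]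

theorem coeff_expSeries_mul (a : ℚ[X]) (f : PowerSeries ℚ[X]) (hf : PowerSeries.coeff 0 f = 0)
    (k : ℕ) : PowerSeries.coeff k (expSeries a * f) =
      ∑ i ∈ Finset.range k, a ^ i * C ((i ! : ℚ)⁻¹) * PowerSeries.coeff (k - i) f := by
  rw [PowerSeries.coeff_mul, Finset.Nat.sum_antidiagonal_eq_sum_range_succ
    (fun i j => PowerSeries.coeff i (expSeries a) * PowerSeries.coeff j f),
    Finset.sum_range_succ, Nat.sub_self, hf, mul_zero, add_zero]
  simp only [coeff_expSeries]

theorem coeff_expSeries_mul_palSeries (a : ℚ[X]) (m k : ℕ) :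
    PowerSeries.coeff k (expSeries a * palSeries m) = ∑ i ∈ Finset.range (k + 1),
      a ^ i * C ((i ! : ℚ)⁻¹) * PowerSeries.coeff (k - i) (palSeries m) := by
  rw [coeff_expSeries_mul _ _ (coeff_zero_palSeries m), Finset.sum_range_succ, Nat.sub_self,
    coeff_zero_palSeries, mul_zero, add_zero]

/-- The factor `(k + m)!` turns multiplication by an exponential into the sum over proper flats of
`sum_flats`, with `k + m` the size of the ground set. -/
theorem factorial_mul_coeff_expSeries_mul (a : ℚ[X]) (f : PowerSeries ℚ[X])
    (hf : PowerSeries.coeff 0 f = 0) (m k : ℕ) :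
    C ((k + m)! : ℚ) * PowerSeries.coeff k (expSeries a * f) =
      ∑ i ∈ Finset.range k, ((k + m).choose i : ℚ[X]) *
        (a ^ i * (C ((k - i + m)! : ℚ) * PowerSeries.coeff (k - i) f)) := by
  rw [coeff_expSeries_mul a f hf, Finset.mul_sum]
  refine Finset.sum_congr rfl fun i hi => ?_
  have hik := Finset.mem_range.1 hi
  have hch : ((k + m)! : ℚ) * (i ! : ℚ)⁻¹ = (k + m).choose i * (k - i + m)! := by
    rw [Nat.cast_choose ℚ (show i ≤ k + m by omega), show k + m - i = k - i + m by omega]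
    have h1 : ((k - i + m)! : ℚ) ≠ 0 := by positivity
    field_simp
  have hC : C ((k + m)! : ℚ) * C (i ! : ℚ)⁻¹ =
      ((k + m).choose i : ℚ[X]) * C ((k - i + m)! : ℚ) := by
    rw [← C_mul, hch, C_mul, C_eq_natCast]
  linear_combination (a ^ i * PowerSeries.coeff (k - i) f) * hC

/-- Terms with `i < j` vanish. Substituting `i = j + s` and `l = j + r + 1` leaves a truncated
alternating sum along row `r + m + 1` of Pascal's triangle, equal to `(-1)^r * (r + m).choose r`. -/
theorem sum_alternating_eq_weight (m l j : ℕ) :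
    ∑ i ∈ Finset.range l, (-1 : ℚ) ^ i * i.choose j * (i ! : ℚ)⁻¹ * ((l - i + m)! : ℚ)⁻¹ =
      weight m l j := by
  rw [weight]
  split_ifs with hj
  · obtain ⟨r, rfl⟩ : ∃ r, l = j + (r + 1) := ⟨l - j - 1, by omega⟩
    rw [Finset.sum_range_add, Finset.sum_eq_zero, zero_add]
    · have hterm : ∀ s ∈ Finset.range (r + 1),
          (-1 : ℚ) ^ (j + s) * (j + s).choose j * ((j + s)! : ℚ)⁻¹ *
            ((j + (r + 1) - (j + s) + m)! : ℚ)⁻¹ =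
          (-1) ^ j / (j ! * (r + m + 1)!) * ((-1) ^ s * (r + m + 1).choose s) := by
        intro s hs
        have hs' := Finset.mem_range.1 hs
        rw [Nat.cast_choose ℚ (show j ≤ j + s by omega),
          Nat.cast_choose ℚ (show s ≤ r + m + 1 by omega),
          show j + (r + 1) - (j + s) + m = r + m + 1 - s by omega, Nat.add_sub_cancel_left, pow_add]
        have h1 : ((j + s)! : ℚ) ≠ 0 := by positivity
        have h2 : ((r + m + 1)! : ℚ) ≠ 0 := by positivity
        field_simp
      have halt := Int.alternating_sum_range_choose_eq_choose (n := r + m) (m := r)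
      have halt' : ∑ s ∈ Finset.range (r + 1), (-1 : ℚ) ^ s * (r + m + 1).choose s =
          (-1) ^ r * (r + m).choose r := by exact_mod_cast halt
      rw [Finset.sum_congr rfl hterm, ← Finset.mul_sum, halt',
        Nat.cast_choose ℚ (Nat.le_add_right r m), Nat.add_sub_cancel_left,
        show j + (r + 1) - j - 1 = r by omega, Nat.factorial_succ]
      have h1 : ((r + m)! : ℚ) ≠ 0 := by positivity
      have h2 : ((r : ℚ) + m + 1) ≠ 0 := by positivity
      have h3 : (((j + (r + 1) : ℕ) : ℚ) + m - j) = r + m + 1 := by push_cast; ring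
      rw [h3]
      push_cast
      field_simp
      ring
    · intro i hi
      rw [Nat.choose_eq_zero_of_lt (Finset.mem_range.1 hi)]
      simp
  · refine Finset.sum_eq_zero fun i hi => ?_
    rw [Nat.choose_eq_zero_of_lt ((Finset.mem_range.1 hi).trans_le (not_lt.1 hj))]
    simp

theorem coeff_expSeries_mul_tailSeries (m l : ℕ) (a : ℚ[X]) :
    PowerSeries.coeff l (expSeries (-(1 + X)) * tailSeries m a) =
      ∑ i ∈ Finset.range l,
        C ((-1 : ℚ) ^ i * (i ! : ℚ)⁻¹ * ((l - i + m)! : ℚ)⁻¹) * ((1 + X) ^ i * a ^ (l - i)) := by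
  rw [coeff_expSeries_mul _ _ (coeff_zero_tailSeries m a)]
  refine Finset.sum_congr rfl fun i hi => ?_
  have := Finset.mem_range.1 hi
  rw [coeff_tailSeries _ _ (by omega), neg_pow, C_mul, C_mul, C_pow, C_neg, C_1]
  ring

theorem coeff_coeff_expSeries_mul_tailSeries_one (m l j : ℕ) :
    (PowerSeries.coeff l (expSeries (-(1 + X)) * tailSeries m 1)).coeff j = weight m l j := by
  rw [coeff_expSeries_mul_tailSeries, finsetSum_coeff, ← sum_alternating_eq_weight]
  refine Finset.sum_congr rfl fun i _ => ?_
  rw [one_pow, mul_one, coeff_C_mul, coeff_one_add_X_pow]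
  ring

/-- Reversal `j ↦ l - j` of the previous coefficient, since `(1 + X)^i` is palindromic. -/
theorem coeff_coeff_expSeries_mul_tailSeries_X (m l j : ℕ) :
    (PowerSeries.coeff l (expSeries (-(1 + X)) * tailSeries m X)).coeff j =
      if j ≤ l then weight m l (l - j) else 0 := by
  rw [coeff_expSeries_mul_tailSeries, finsetSum_coeff, ← sum_alternating_eq_weight]
  split_ifs with hj
  · refine Finset.sum_congr rfl fun i hi => ?_
    have hi' := Finset.mem_range.1 hi
    rw [coeff_C_mul, coeff_mul_X_pow']
    split_ifs with hji
    · rw [coeff_one_add_X_pow, ← Nat.choose_symm (show j - (l - i) ≤ i by omega),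
        show i - (j - (l - i)) = l - j by omega]
      ring
    · rw [Nat.choose_eq_zero_of_lt (show i < l - j by omega)]
      simp
  · refine Finset.sum_eq_zero fun i hi => ?_
    have hi' := Finset.mem_range.1 hi
    rw [coeff_C_mul, coeff_mul_X_pow', if_pos (by omega), coeff_one_add_X_pow,
      Nat.choose_eq_zero_of_lt (by omega)]
    simp

/-! ### The Kazhdan–Lusztig series and its degree bounds. -/

/-- The exponential generating function of the Kazhdan–Lusztig polynomials of the uniform
matroids of corank `m` and positive rank. -/
noncomputable def klSeries (m : ℕ) : PowerSeries ℚ[X] :=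
  expSeries 1 * palSeries m - expSeries (-X) * tailSeries m X

/-- The exponential generating function of the reversed Kazhdan–Lusztig polynomials of the uniform
matroids of corank `m` and positive rank. -/
noncomputable def revKlSeries (m : ℕ) : PowerSeries ℚ[X] :=
  expSeries X * palSeries m - expSeries (-1) * tailSeries m 1

theorem klSeries_eq (m : ℕ) :
    klSeries m = expSeries 1 * (palSeries m - expSeries (-(1 + X)) * tailSeries m X) := by
  rw [klSeries, mul_sub, ← mul_assoc, expSeries_mul]
  ring_nf

theorem revKlSeries_eq (m : ℕ) :
    revKlSeries m = expSeries X * (palSeries m - expSeries (-(1 + X)) * tailSeries m 1) := by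
  rw [revKlSeries, mul_sub, ← mul_assoc, expSeries_mul]
  ring_nf

theorem coeff_zero_expSeries_mul_tailSeries (m : ℕ) (a b : ℚ[X]) :
    PowerSeries.coeff 0 (expSeries a * tailSeries m b) = 0 := by
  rw [coeff_expSeries_mul _ _ (coeff_zero_tailSeries m b), Finset.sum_range_zero]

theorem coeff_zero_klSeries (m : ℕ) : PowerSeries.coeff 0 (klSeries m) = 0 := by
  rw [klSeries, map_sub, coeff_zero_expSeries_mul_tailSeries,
    coeff_expSeries_mul _ _ (coeff_zero_palSeries m), Finset.sum_range_zero, sub_zero]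

/-- In the factored form `klSeries_eq`, the upper halves, middle included, of the coefficients of
the second factor cancel; multiplying by `exp x` preserves this. -/
theorem coeff_coeff_klSeries {m k j : ℕ} (hj : k ≤ 2 * j) :
    (PowerSeries.coeff k (klSeries m)).coeff j = 0 := by
  rw [klSeries_eq, coeff_expSeries_mul, finsetSum_coeff]
  · refine Finset.sum_eq_zero fun i _ => ?_
    rw [one_pow, one_mul, coeff_C_mul, map_sub, coeff_sub, coeff_coeff_palSeries,
      coeff_coeff_expSeries_mul_tailSeries_X, min_eq_right (by omega), sub_self, mul_zero]
  · rw [map_sub, coeff_zero_palSeries, coeff_zero_expSeries_mul_tailSeries, sub_zero]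

/-- Here the lower halves, middle included, cancel. Multiplying by `exp (X x)` shifts both degrees
by `i`, and `2 * j ≤ k` gives `2 * (j - i) ≤ k - i`. -/
theorem coeff_coeff_revKlSeries {m k j : ℕ} (hj : 2 * j ≤ k) :
    (PowerSeries.coeff k (revKlSeries m)).coeff j = 0 := by
  rw [revKlSeries_eq, coeff_expSeries_mul, finsetSum_coeff]
  · refine Finset.sum_eq_zero fun i _ => ?_
    rw [mul_assoc, coeff_X_pow_mul']
    split_ifs with hij
    · rw [coeff_C_mul, map_sub, coeff_sub, coeff_coeff_palSeries,
        coeff_coeff_expSeries_mul_tailSeries_one, if_pos (by omega), min_eq_left (by omega),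
        sub_self, mul_zero]
    · rfl
  · rw [map_sub, coeff_zero_palSeries, coeff_zero_expSeries_mul_tailSeries, sub_zero]

theorem revKlSeries_eq_add (m : ℕ) :
    revKlSeries m = expSeries (X - 1) * klSeries m +
      (expSeries (-1) * tailSeries m X - expSeries (-1) * tailSeries m 1) := by
  rw [revKlSeries, klSeries, mul_sub, ← mul_assoc, ← mul_assoc, expSeries_mul, expSeries_mul]
  ring_nf

theorem expSeries_X_mul_klSeries_add (m : ℕ) :
    expSeries X * klSeries m + tailSeries m X = expSeries (1 + X) * palSeries m := by
  have h0 : expSeries 0 = 1 := by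
    ext i : 1
    rw [coeff_expSeries, PowerSeries.coeff_one]
    rcases i with _ | i <;> simp
  rw [klSeries, mul_sub, ← mul_assoc, ← mul_assoc, expSeries_mul, expSeries_mul, add_neg_cancel, h0]
  ring_nf

/-- The Kazhdan–Lusztig polynomial of the uniform matroid of rank `k > 0` and corank `m`. -/
noncomputable def uniformKL (m k : ℕ) : ℚ[X] :=
  C ((k + m)! : ℚ) * PowerSeries.coeff k (klSeries m)

theorem factorial_mul_coeff_tailSeries (m : ℕ) (a : ℚ[X]) {l : ℕ} (hl : l ≠ 0) :
    C ((l + m)! : ℚ) * PowerSeries.coeff l (tailSeries m a) = a ^ l := by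
  rw [coeff_tailSeries _ _ hl, mul_left_comm, ← C_mul, mul_inv_cancel₀ (by positivity), C_1,
    mul_one]

/-- The left side is the Kazhdan–Lusztig sum over flats: the first sum collects the proper flats,
the second is the characteristic polynomial of the whole matroid. -/
theorem sum_mul_uniformKL_add (m k : ℕ) :
    ∑ i ∈ Finset.range k, ((k + m).choose i : ℚ[X]) * ((X - 1) ^ i * uniformKL m (k - i)) +
      ∑ i ∈ Finset.range k, ((k + m).choose i : ℚ[X]) * ((-1) ^ i * (X ^ (k - i) - 1)) =
    C ((k + m)! : ℚ) * PowerSeries.coeff k (revKlSeries m) := by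
  rw [revKlSeries_eq_add, map_add, map_sub, mul_add, mul_sub,
    factorial_mul_coeff_expSeries_mul _ _ (coeff_zero_klSeries m),
    factorial_mul_coeff_expSeries_mul _ _ (coeff_zero_tailSeries m X),
    factorial_mul_coeff_expSeries_mul _ _ (coeff_zero_tailSeries m 1), ← Finset.sum_sub_distrib]
  congr 1
  refine Finset.sum_congr rfl fun i hi => ?_
  have := Finset.mem_range.1 hi
  rw [factorial_mul_coeff_tailSeries _ _ (by omega), factorial_mul_coeff_tailSeries _ _ (by omega)]
  ring

theorem sum_X_pow_mul_uniformKL_add (m : ℕ) {k : ℕ} (hk : k ≠ 0) :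
    ∑ i ∈ Finset.range k, ((k + m).choose i : ℚ[X]) * (X ^ i * uniformKL m (k - i)) + X ^ k =
    C ((k + m)! : ℚ) * PowerSeries.coeff k (expSeries (1 + X) * palSeries m) := by
  rw [← expSeries_X_mul_klSeries_add, map_add, mul_add,
    factorial_mul_coeff_expSeries_mul _ _ (coeff_zero_klSeries m),
    factorial_mul_coeff_tailSeries _ _ hk]
  rfl

/-- For even `l` the middle term `j = l / 2` is counted only in the first sum. -/
theorem coeff_palSeries (m l : ℕ) :
    PowerSeries.coeff l (palSeries m) =
      ∑ j ∈ Finset.range (l / 2 + 1), C (weight m l j) * X ^ j +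
      ∑ j ∈ Finset.range ((l + 1) / 2), C (weight m l j) * X ^ (l - j) := by
  have h : Finset.range (l + 1) = Finset.range ((l / 2 + 1) + (l + 1) / 2) := by
    congr 1
    omega
  rw [palSeries, PowerSeries.coeff_mk, h, Finset.sum_range_add]
  congr 1
  · refine Finset.sum_congr rfl fun j hj => ?_
    have := Finset.mem_range.1 hj
    rw [min_eq_left (by omega), C_mul_X_pow_eq_monomial]
  · rw [← Finset.sum_range_reflect]
    refine Finset.sum_congr rfl fun j hj => ?_
    have := Finset.mem_range.1 hj
    rw [show l / 2 + 1 + ((l + 1) / 2 - 1 - j) = l - j by omega, min_eq_right (by omega),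
      C_mul_X_pow_eq_monomial, show l - (l - j) = j by omega]

end UniformKL

/-! ### Identification of `klPoly` and `zPoly` with the series coefficients. -/

namespace Matroid.IsUniformOfRank

open UniformKL

variable {α : Type*} [Finite α] {M : Matroid α}

theorem klPoly_map_contract_ground (M : Matroid α) :
    (M ／ M.E).klPoly.map (Int.castRingHom ℚ) = 1 := by
  rw [klPoly, if_pos M.natRank_contract_ground, Polynomial.map_one]

theorem klPoly_map_eq (m k : ℕ) :
    ∀ {M : Matroid α}, M.IsUniformOfRank k → 0 < k → M.E.ncard = k + m →
      M.klPoly.map (Int.castRingHom ℚ) = uniformKL m k := by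
  classical
  induction k using Nat.strong_induction_on with
  | _ k ih =>
    intro M h hk hE
    have hl := h.loops_eq_empty hk
    have hEne : M.E ≠ ∅ := fun h0 => by rw [h0, Set.ncard_empty] at hE; omega
    -- The added `uniformKL m k` plays the part of the term of the empty flat, which the recursion
    -- for `klPoly` omits.
    have hsum : (∑ F ∈ M.flats with F ≠ M.loops, (M ↾ F).charPoly * (M ／ F).klPoly).map
        (Int.castRingHom ℚ) + uniformKL m k =
          C ((k + m)! : ℚ) * PowerSeries.coeff k (revKlSeries m) := by
      rw [← sum_mul_uniformKL_add, Polynomial.map_sum, Finset.sum_filter,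
        h.sum_flats _ (fun i => if i = 0 then 0 else (X - 1) ^ i * uniformKL m (k - i)), hE]
      · have hmul : ∀ p : ℤ[X], (p * (M ／ M.E).klPoly).map (Int.castRingHom ℚ) =
            p.map (Int.castRingHom ℚ) := fun p => by
          rw [Polynomial.map_mul, klPoly_map_contract_ground, mul_one]
        rw [if_pos (hl ▸ hEne), hmul, restrict_ground_eq_self, h.charPoly_eq hk, hE,
          Polynomial.map_sum, add_right_comm]
        congr 1
        · obtain ⟨r, rfl⟩ : ∃ r, k = r + 1 := ⟨k - 1, by omega⟩
          rw [Finset.sum_range_succ', Finset.sum_range_succ']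
          simp
        · exact Finset.sum_congr rfl fun i _ => by simp
      · intro F hF hlt
        rw [hl]
        by_cases hF0 : F = ∅
        · simp [hF0]
        · have hpos : 0 < F.ncard := by rwa [Set.ncard_pos, Set.nonempty_iff_ne_empty]
          rw [if_pos hF0, if_neg hpos.ne', Polynomial.map_mul,
            (h.restrict hF hlt.le).charPoly_of_ncard_ground hpos rfl,
            ih _ (by omega) (h.contract hF hlt.le) (by omega)
              (by rw [ncard_contract_ground hF, hE]; omega)]
          simp
    rw [klPoly_eq M (by rw [h.natRank_eq]; exact hk.ne'), h.natRank_eq]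
    ext j
    rw [coeff_map, coeff_neg, finsetSum_coeff]
    simp only [coeff_monomial, Finset.sum_ite_eq', Finset.mem_filter, Finset.mem_range]
    split_ifs with hj
    -- Below half the rank the right side of `hsum` has zero coefficient, so `uniformKL` satisfies
    -- the recursion; from half the rank on, both polynomials vanish.
    · have hc := congrArg (fun p : ℚ[X] => p.coeff j) hsum
      simp only [coeff_add, coeff_C_mul, coeff_map] at hc
      rw [coeff_coeff_revKlSeries hj.2.le, mul_zero] at hc
      rw [map_neg]
      convert neg_eq_of_add_eq_zero_right hc
    · rw [uniformKL, coeff_C_mul, coeff_coeff_klSeries (by omega)]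
      simp

theorem zPoly_map_eq {k m : ℕ} (h : M.IsUniformOfRank k) (hk : 0 < k) (hE : M.E.ncard = k + m) :
    M.zPoly.map (Int.castRingHom ℚ) =
      C ((k + m)! : ℚ) * PowerSeries.coeff k (expSeries (1 + X) * palSeries m) := by
  rw [← sum_X_pow_mul_uniformKL_add m hk.ne', zPoly, Polynomial.map_sum,
    h.sum_flats _ (fun i => X ^ i * uniformKL m (k - i)), hE]
  · rw [Polynomial.map_mul, klPoly_map_contract_ground, mul_one, restrict_ground_eq_self,
      h.natRank_eq]
    simp
  · intro F hF hlt
    rw [Polynomial.map_mul, (h.restrict hF hlt.le).natRank_eq,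
      klPoly_map_eq m _ (h.contract hF hlt.le) (by omega)
        (by rw [ncard_contract_ground hF, hE]; omega)]
    simp

end Matroid.IsUniformOfRank

/-! ### The multinomial form of the weights and the final formula. -/

theorem multinomialCoeff_eq_weight (m : ℕ) {k i j : ℕ} (hij : i + j ≤ k) :
    (-1 : ℚ) ^ (k - i + 1) / (((k + m : ℕ) : ℚ) - i - j) *
      multinomialCoeff (k + m) [1, (i : ℤ), (j : ℤ), ((k + m : ℕ) : ℤ) - k, (k : ℤ) - i - j - 1] =
    (k + m)! * ((i ! : ℚ)⁻¹ * UniformKL.weight m (k - i) j) := by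
  rw [multinomialCoeff, UniformKL.weight]
  rcases hij.eq_or_lt with heq | hlt
  -- For `i + j = k` both sides are zero by convention: the last multinomial entry is `-1`, and
  -- `weight` requires `j < k - i`. The possibly zero denominator does no harm.
  · rw [if_neg, if_neg (by omega)]
    · simp
    · intro hall
      have := hall ((k : ℤ) - i - j - 1) (by simp)
      omega
  · obtain ⟨r, rfl⟩ : ∃ r, k = i + j + r + 1 := ⟨k - i - j - 1, by omega⟩
    have h1 : ((i + j + r + 1 + m : ℕ) : ℤ) - (i + j + r + 1 : ℕ) = (m : ℤ) := by push_cast; ring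
    have h2 : ((i + j + r + 1 : ℕ) : ℤ) - i - j - 1 = (r : ℤ) := by push_cast; ring
    have h3 : i + j + r + 1 - i = j + r + 1 := by omega
    have h4 : j + r + 1 - j - 1 = r := by omega
    have h5 : ((i + j + r + 1 + m : ℕ) : ℚ) - i - j = r + 1 + m := by push_cast; ring
    have h6 : ((j + r + 1 : ℕ) : ℚ) + m - j = r + 1 + m := by push_cast; ring
    rw [h1, h2, h3, h4, h5, h6, if_pos (by simp), if_pos (by omega)]
    have h7 : ((r : ℚ) + 1 + m) ≠ 0 := by positivity
    simp only [List.map_cons, List.map_nil, List.prod_cons, List.prod_nil, Int.toNat_natCast,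
      Int.toNat_one, Nat.factorial_one, Nat.cast_one]
    field_simp

/-- The new formula for the `Z`-polynomial of the uniform matroid `U_{k,n}`, as an identity
in `ℚ[t]`. -/
theorem corollary4p2 (k n : ℕ) (hk : 1 ≤ k) (hkn : k ≤ n) :
    (uniformMatroid k n).zPoly.map (Int.castRingHom ℚ) =
      ∑ j ∈ Finset.Icc 0 (k / 2), ∑ i ∈ Finset.Icc 0 (k - 2 * j),
        C ((-1 : ℚ) ^ (k - i + 1) / ((n : ℚ) - i - j) *
            multinomialCoeff n [1, (i : ℤ), (j : ℤ), (n : ℤ) - k, (k : ℤ) - i - j - 1]) *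
          (1 + X) ^ i * X ^ j +
      ∑ j ∈ Finset.Icc 0 ((k - 1) / 2), ∑ i ∈ Finset.Icc 0 (k - 2 * j - 1),
        C ((-1 : ℚ) ^ (k - i + 1) / ((n : ℚ) - i - j) *
            multinomialCoeff n [1, (i : ℤ), (j : ℤ), (n : ℤ) - k, (k : ℤ) - i - j - 1]) *
          (1 + X) ^ i * X ^ (k - i - j) := by
  obtain ⟨m, rfl⟩ := Nat.exists_eq_add_of_le hkn
  have hE : (uniformMatroid k (k + m)).E.ncard = k + m := by
    rw [uniformMatroid_ground, Set.ncard_univ, Nat.card_fin]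
  -- Exchanging the sums puts the power `i` of `1 + X` outside, so that the inner sums over `j`
  -- become the two halves of the coefficient of `x^(k - i)` in `palSeries`. The index `i = k` is
  -- allowed, as that coefficient is then zero.
  rw [(isUniformOfRank_uniformMatroid hkn).zPoly_map_eq hk hE,
    Finset.sum_comm' (t' := Finset.range (k + 1)) (s' := fun i => Finset.range ((k - i) / 2 + 1))
      (fun j i => by simp only [Finset.mem_Icc, Finset.mem_range]; omega),
    Finset.sum_comm' (s := Finset.Icc 0 ((k - 1) / 2)) (t' := Finset.range (k + 1))
      (s' := fun i => Finset.range ((k - i + 1) / 2))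
      (fun j i => by simp only [Finset.mem_Icc, Finset.mem_range]; omega),
    ← Finset.sum_add_distrib, UniformKL.coeff_expSeries_mul_palSeries, Finset.mul_sum]
  refine Finset.sum_congr rfl fun i hi => ?_
  have hik := Finset.mem_range.1 hi
  rw [UniformKL.coeff_palSeries, mul_add, mul_add, Finset.mul_sum, Finset.mul_sum,
    Finset.mul_sum, Finset.mul_sum]
  refine congrArg₂ (· + ·) (Finset.sum_congr rfl fun j hj => ?_)
    (Finset.sum_congr rfl fun j hj => ?_)
  · have hjk := Finset.mem_range.1 hj
    rw [multinomialCoeff_eq_weight m (show i + j ≤ k by omega), C_mul, C_mul]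
    generalize C ((k + m)! : ℚ) = a
    ring
  · have hjk := Finset.mem_range.1 hj
    rw [multinomialCoeff_eq_weight m (show i + j ≤ k by omega), C_mul, C_mul]
    generalize C ((k + m)! : ℚ) = a
    ring
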